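/- Let $d,k\ge 1$ be integers, $\alpha>0$, $\lambda>0$, and let $x_1,\dots,x_n\in\mathbb R^d$. Let $\pi^\diamond\in\mathbb R^n$ satisfy $\pi^\diamond\ge 0$ and $\sum_{i=1}^n\pi^\diamond_i=k$ (for instance, a minimizer of $f\big(\sum_i\pi_i x_ix_i^\top+\lambda I\big)$ over all such weights, for a design criterion $f$). Put $$\Sigma_\diamond=\sum_{i=1}^n \pi_i^\diamond x_ix_i^\top+\lambda I,\qquad \tilde x_i=\Sigma_\diamond^{-1/2}x_i .$$ Let $\Delta_d$ be the set of symmetric positive semidefinite $d\times d$ real matrices of trace $1$, and $\langle A,B\rangle=\operatorname{Tr}(A^\top B)$. For indices $i_1,\dots,i_k\in\{1,\dots,n\}$ let $$F_t=\tilde x_{i_t}\tilde x_{i_t}^\top+\frac{\lambda}{k}\Sigma_\diamond^{-1}\quad(1\le t\le k),\qquad F=\sum_{t=1}^k F_t .$$ Given a regularizer $w:\Delta_d\to\mathbb R$, suppose the matrices $A_1,\dots,A_k$ are chosen by Follow-the-Regularized-Leader (FTRL), that is, for each $t$, $A_t$ minimizes $\alpha\sum_{s=1}^{t-1}\langle A,F_s\rangle+w(A)$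 over $A\in\Delta_d$. (a) Entropy regularizer, $w(A)=\langle A,\log A-I\rangle$ (with $0\log 0=0$). Each $A_t$ is positive definite, there is exactly one symmetric positive definite matrix $B_t$ with $$\log B_t=\log A_t-\frac{\alpha\lambda}{k}\Sigma_\diamond^{-1},$$ and $$\lambda_{\min}(F)\ \ge\ -\frac{\log d}{\alpha}+\frac1\alpha\sum_{t=1}^k\left\{\operatorname{Tr}(A_t-B_t)+\left[1-\exp\left(-\alpha\|\tilde x_{i_t}\|_2^2\right)\right]\frac{\tilde x_{i_t}^\top B_t\tilde x_{i_t}}{\|\tilde x_{i_t}\|_2^2}\right\},$$ where the last summand in the braces is read as $0$ if $\tilde x_{i_t}=0$. (b) $\ell_{1/2}$-regularizer, $w(A)=-2\operatorname{Tr}(A^{1/2})$. Each $A_t$ is positive definite, there is exactly one symmetric positive definite matrix $B_t$ with $$B_t^{-1/2}=A_t^{-1/2}+\frac{\alpha\lambda}{k}\Sigma_\diamond^{-1},$$ and $$\lambda_{\min}(F)\ \ge\ -\frac{2\sqrt d}{\alpha}+\frac1\alpha\sum_{t=1}^k\left\{\operatorname{Tr}\left(A_t^{1/2}-B_t^{1/2}\right)+\frac{\alpha\,\tilde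 x_{i_t}^\top B_t\tilde x_{i_t}}{1+\alpha\,\tilde x_{i_t}^\top B_t^{1/2}\tilde x_{i_t}}\right\}.$$ -/

import Mathlib

open scoped Matrix

noncomputable section

namespace RegDesign

/-- `log A` of a symmetric matrix, through its spectral decomposition. -/
def mlog {d : ℕ} (A : Matrix (Fin d) (Fin d) ℝ) : Matrix (Fin d) (Fin d) ℝ :=
  cfc Real.log A

/-- The real power `A ^ p` of a symmetric positive (semi)definite matrix, through its spectral
decomposition. -/
def mpow {d : ℕ} (A : Matrix (Fin d) (Fin d) ℝ) (p : ℝ) : Matrix (Fin d) (Fin d) ℝ :=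
  cfc (fun s : ℝ => s ^ p) A

/-- The Frobenius inner product `⟨A, B⟩ = Tr (Aᵀ B)`. -/
def frob {d : ℕ} (A B : Matrix (Fin d) (Fin d) ℝ) : ℝ := (Aᵀ * B).trace

/-- The smallest eigenvalue of a symmetric matrix. -/
def lamMin {d : ℕ} (A : Matrix (Fin d) (Fin d) ℝ) : ℝ := sInf (spectrum ℝ A)

/-- The action set `Δ_d`: positive semidefinite matrices of trace one. -/
def actionSet (d : ℕ) : Set (Matrix (Fin d) (Fin d) ℝ) :=
  {A | A.PosSemidef ∧ A.trace = 1}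

/-- The entropy regularizer `w(A) = ⟨A, log A - I⟩` (with `0 log 0 = 0` on the kernel of `A`). -/
def entropyReg {d : ℕ} (A : Matrix (Fin d) (Fin d) ℝ) : ℝ := frob A (mlog A - 1)

/-- The `ℓ_{1/2}` regularizer `w(A) = -2 Tr (A^{1/2})`. -/
def halfReg {d : ℕ} (A : Matrix (Fin d) (Fin d) ℝ) : ℝ := -2 * (mpow A (1 / 2)).trace

/-- `A_1, …, A_k` are chosen by Follow-the-Regularized-Leader against the losses `F_1, …, F_k`:
every `A_t` minimizes `α ∑_{s < t} ⟨A, F_s⟩ + w(A)` over `Δ_d` (just `w(A)` in the first round). -/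
def IsFTRL {d k : ℕ} (w : Matrix (Fin d) (Fin d) ℝ → ℝ) (α : ℝ)
    (F A : Fin k → Matrix (Fin d) (Fin d) ℝ) : Prop :=
  ∀ t : Fin k, A t ∈ actionSet d ∧
    IsMinOn (fun M => α * ∑ s ∈ Finset.univ.filter (fun s => s < t), frob M (F s) + w M)
      (actionSet d) (A t)

/-- The regularized weighted covariance `Σ_⋄ = ∑ i, π_i x_i x_iᵀ + λ I`. -/
def sigmaReg {d n : ℕ} (x : Fin n → Fin d → ℝ) (p : Fin n → ℝ) (lam : ℝ) :
    Matrix (Fin d) (Fin d) ℝ :=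
  ∑ i, p i • Matrix.vecMulVec (x i) (x i) + lam • (1 : Matrix (Fin d) (Fin d) ℝ)

/-- The denoised points `x̃_i = Σ_⋄^{-1/2} x_i`. -/
def denoised {d n : ℕ} (x : Fin n → Fin d → ℝ) (p : Fin n → ℝ) (lam : ℝ) (i : Fin n) :
    Fin d → ℝ :=
  mpow (sigmaReg x p lam) (-1 / 2) *ᵥ x i

/-- The loss matrix `x̃_i x̃_iᵀ + (λ / k) Σ_⋄⁻¹`. -/
def regLoss {d n : ℕ} (x : Fin n → Fin d → ℝ) (p : Fin n → ℝ) (lam : ℝ) (k : ℕ) (i : Fin n) :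
    Matrix (Fin d) (Fin d) ℝ :=
  Matrix.vecMulVec (denoised x p lam i) (denoised x p lam i)
    + (lam / (k : ℝ)) • (sigmaReg x p lam)⁻¹

/-- The quadratic form `vᵀ M v`. -/
def quad {d : ℕ} (M : Matrix (Fin d) (Fin d) ℝ) (v : Fin d → ℝ) : ℝ := v ⬝ᵥ (M *ᵥ v)

/-- `M` is the symmetric positive definite matrix with
`log M = log A - (α λ / k) Σ_⋄⁻¹`. -/
def IsEntropyModified {d : ℕ} (α lam : ℝ) (k : ℕ) (S A M : Matrix (Fin d) (Fin d) ℝ) : Prop :=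
  M.PosDef ∧ mlog M = mlog A - (α * lam / (k : ℝ)) • S⁻¹

/-- `M` is the symmetric positive definite matrix with
`M^{-1/2} = A^{-1/2} + (α λ / k) Σ_⋄⁻¹`. -/
def IsHalfModified {d : ℕ} (α lam : ℝ) (k : ℕ) (S A M : Matrix (Fin d) (Fin d) ℝ) : Prop :=
  M.PosDef ∧ mpow M (-1 / 2) = mpow A (-1 / 2) + (α * lam / (k : ℝ)) • S⁻¹

end RegDesign

end

/-! Both bounds come from a potential `Φ(G)`, up to sign and a constant the optimal value of the
FTRL problem with cumulative loss `G`. One round satisfies `Φ(G + F_t) + e_t ≤ Φ(G)` with `e_t` the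
summand in braces; telescoping from `Φ(0)` and comparing `Φ(F)` with `-α μ` for each eigenvalue `μ`
of `F` gives the result. Entropy: `Φ(G) = log Tr exp(-α G)`. A sharpened Gibbs principle identifies
`A_t` as the normalized exponential (`entropy_minimizer_eq`). Then `exp(log B_t - α v vᵀ)` is the
next exponential up to the old normalization, so the step (`entropy_step`) is Golden–Thompson for a
rank-one perturbation (`trace_exp_sub_rankOne_le`) followed by `log y ≤ y - 1`. Here `Φ(0) = log d`.
Half power: `Φ(G) = ν + Tr (α G + ν I)⁻¹`, with `ν` chosen so that `(α G + ν I)⁻²` has trace one.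
The duality gap is a trace `Tr (D K D)` (`trace_half_gap`): its vanishing identifies `A_t`, and its
nonnegativity, with Sherman–Morrison, gives `half_step`. Here `Φ(0) = 2 √d`. -/

open scoped Matrix

/-! ### Spectral calculus in eigenvector coordinates and Klein's inequality. -/

namespace Matrix.IsHermitian

variable {ι : Type*} [Fintype ι] [DecidableEq ι] {X Y : Matrix ι ι ℝ}

/-- An orthonormal family of eigenvectors, as plain functions. -/
noncomputable def eigvec (hX : X.IsHermitian) (i : ι) : ι → ℝ := ⇑(hX.eigenvectorBasis i)

theorem eigvec_dotProduct (hX : X.IsHermitian) (i j : ι) :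
    hX.eigvec i ⬝ᵥ hX.eigvec j = if i = j then 1 else 0 := by
  have h := orthonormal_iff_ite.1 hX.eigenvectorBasis.orthonormal j i
  rw [EuclideanSpace.inner_eq_star_dotProduct] at h
  simpa [eigvec, eq_comm] using h

theorem cfc_eq_sum (hX : X.IsHermitian) (f : ℝ → ℝ) :
    cfc f X = ∑ i, f (hX.eigenvalues i) • vecMulVec (hX.eigvec i) (hX.eigvec i) := by
  rw [hX.cfc_eq, Matrix.IsHermitian.cfc, Unitary.conjStarAlgAut_apply]
  ext a b
  simp only [Matrix.mul_apply, Matrix.sum_apply, Matrix.smul_apply, vecMulVec_apply,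
    Matrix.diagonal_apply, Matrix.star_apply, smul_eq_mul]
  refine Finset.sum_congr rfl fun i _ => ?_
  simp [eigvec, eigenvectorUnitary_apply]
  ring

theorem cfc_id_matrix (hX : X.IsHermitian) : cfc (fun s : ℝ => s) X = X := by
  have h : IsSelfAdjoint X := hX
  exact cfc_id' ℝ X

theorem cfc_isHermitian (f : ℝ → ℝ) (X : Matrix ι ι ℝ) : (cfc f X).IsHermitian :=
  cfc_predicate f X

/-- The spectrum is finite, so every function is continuous on it; no continuity hypothesis is
needed, even for `log` or powers at `0`. -/
theorem cfc_comp_matrix (hX : X.IsHermitian) (f g : ℝ → ℝ) :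
    cfc f (cfc g X) = cfc (fun s => f (g s)) X := by
  have h : IsSelfAdjoint X := hX
  exact (cfc_comp' f g X ((X.finite_real_spectrum.image g).continuousOn f)
    (X.finite_real_spectrum.continuousOn g)).symm

theorem cfc_mul_matrix (f g : ℝ → ℝ) (X : Matrix ι ι ℝ) :
    cfc f X * cfc g X = cfc (fun s => f s * g s) X :=
  (cfc_mul f g X (X.finite_real_spectrum.continuousOn f)
    (X.finite_real_spectrum.continuousOn g)).symm

theorem spectrum_cfc (hX : X.IsHermitian) (f : ℝ → ℝ) :
    spectrum ℝ (cfc f X) = f '' spectrum ℝ X := by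
  have h : IsSelfAdjoint X := hX
  exact cfc_map_spectrum f X h (X.finite_real_spectrum.continuousOn f)

theorem posDef_iff_spectrum (hX : X.IsHermitian) : X.PosDef ↔ ∀ s ∈ spectrum ℝ X, 0 < s := by
  rw [hX.posDef_iff_eigenvalues_pos, hX.spectrum_real_eq_range_eigenvalues, Set.forall_mem_range]

theorem posSemidef_iff_spectrum (hX : X.IsHermitian) :
    X.PosSemidef ↔ ∀ s ∈ spectrum ℝ X, 0 ≤ s := by
  rw [hX.posSemidef_iff_eigenvalues_nonneg, hX.spectrum_real_eq_range_eigenvalues,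
    Set.forall_mem_range]
  rfl

theorem posDef_cfc (hX : X.IsHermitian) {f : ℝ → ℝ} (hf : ∀ s ∈ spectrum ℝ X, 0 < f s) :
    (cfc f X).PosDef := by
  rw [posDef_iff_spectrum (cfc_isHermitian f X), spectrum_cfc hX]
  rintro _ ⟨s, hs, rfl⟩
  exact hf s hs

theorem dotProduct_cfc_mul_cfc (hX : X.IsHermitian) (hY : Y.IsHermitian) (f g : ℝ → ℝ)
    (u v : ι → ℝ) :
    u ⬝ᵥ ((cfc f X * cfc g Y) *ᵥ v) = ∑ i, ∑ j, f (hX.eigenvalues i) * g (hY.eigenvalues j) *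
      ((u ⬝ᵥ hX.eigvec i) * (hX.eigvec i ⬝ᵥ hY.eigvec j) * (hY.eigvec j ⬝ᵥ v)) := by
  rw [hX.cfc_eq_sum, hY.cfc_eq_sum, Finset.sum_mul_sum, sum_mulVec, dotProduct_sum]
  refine Finset.sum_congr rfl fun i _ => ?_
  rw [sum_mulVec, dotProduct_sum]
  refine Finset.sum_congr rfl fun j _ => ?_
  rw [smul_mul_smul_comm, smul_mulVec, dotProduct_smul, vecMulVec_mul_vecMulVec, vecMulVec_mulVec]
  simp only [dotProduct_smul, op_smul_eq_smul, smul_eq_mul, smul_dotProduct]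
  ring

theorem dotProduct_cfc (hX : X.IsHermitian) (f : ℝ → ℝ) (u : ι → ℝ) :
    u ⬝ᵥ (cfc f X *ᵥ u) = ∑ i, f (hX.eigenvalues i) * (u ⬝ᵥ hX.eigvec i) ^ 2 := by
  rw [hX.cfc_eq_sum, sum_mulVec, dotProduct_sum]
  refine Finset.sum_congr rfl fun i _ => ?_
  rw [smul_mulVec, dotProduct_smul, vecMulVec_mulVec]
  simp only [dotProduct_smul, op_smul_eq_smul, smul_eq_mul, dotProduct_comm (hX.eigvec i)]
  ring

theorem sum_sq_dotProduct_eigvec (hX : X.IsHermitian) (u : ι → ℝ) :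
    ∑ i, (u ⬝ᵥ hX.eigvec i) ^ 2 = u ⬝ᵥ u := by
  have h : IsSelfAdjoint X := hX
  have := hX.dotProduct_cfc (fun _ => 1) u
  rw [cfc_const_one ℝ X] at this
  simpa using this.symm

theorem trace_cfc (hX : X.IsHermitian) (f : ℝ → ℝ) :
    (cfc f X).trace = ∑ i, f (hX.eigenvalues i) := by
  rw [hX.cfc_eq_sum, trace_sum]
  simp [trace_vecMulVec, eigvec_dotProduct]

theorem trace_cfc_mul_cfc (hX : X.IsHermitian) (hY : Y.IsHermitian) (f g : ℝ → ℝ) :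
    (cfc f X * cfc g Y).trace = ∑ i, ∑ j, f (hX.eigenvalues i) * g (hY.eigenvalues j) *
      (hX.eigvec i ⬝ᵥ hY.eigvec j) ^ 2 := by
  rw [hX.cfc_eq_sum, hY.cfc_eq_sum, Finset.sum_mul_sum, trace_sum]
  refine Finset.sum_congr rfl fun i _ => ?_
  rw [trace_sum]
  refine Finset.sum_congr rfl fun j _ => ?_
  rw [smul_mul_smul_comm, trace_smul, vecMulVec_mul_vecMulVec, trace_vecMulVec]
  simp only [dotProduct_smul, smul_eq_mul]
  ring

/-- **Klein's inequality** in Peierls form: a scalar inequality for sums of products `f (s) g (t)`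
passes to the traces of products of functions of two Hermitian matrices. -/
theorem sum_trace_cfc_mul_cfc_nonneg (hX : X.IsHermitian) (hY : Y.IsHermitian) {m : ℕ}
    (f g : Fin m → ℝ → ℝ)
    (h : ∀ s ∈ spectrum ℝ X, ∀ t ∈ spectrum ℝ Y, 0 ≤ ∑ l, f l s * g l t) :
    0 ≤ ∑ l, (cfc (f l) X * cfc (g l) Y).trace := by
  simp_rw [hX.trace_cfc_mul_cfc hY]
  rw [Finset.sum_comm]
  refine Finset.sum_nonneg fun i _ => ?_
  rw [Finset.sum_comm]
  refine Finset.sum_nonneg fun j _ => ?_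
  rw [← Finset.sum_mul]
  exact mul_nonneg (h _ (hX.eigenvalues_mem_spectrum_real i) _ (hY.eigenvalues_mem_spectrum_real j))
    (sq_nonneg _)

end Matrix.IsHermitian

/-! ### Rank-one Golden–Thompson inequality. -/

namespace Matrix.IsHermitian

variable {ι : Type*} [Fintype ι] [DecidableEq ι] {X Y : Matrix ι ι ℝ}

theorem cfc_one_matrix (hX : X.IsHermitian) : cfc (fun _ : ℝ => (1 : ℝ)) X = 1 := by
  have h : IsSelfAdjoint X := hX
  exact cfc_const_one ℝ X

/-- Klein's inequality applied to the tangent line bound `e^t ≥ e^s + e^s (t - s)`, written as three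
products. -/
theorem trace_exp_tangent_le (hX : X.IsHermitian) (hY : Y.IsHermitian) :
    (cfc Real.exp X).trace + (cfc Real.exp X * (Y - X)).trace ≤ (cfc Real.exp Y).trace := by
  have h := hX.sum_trace_cfc_mul_cfc_nonneg hY
    ![fun _ => 1, fun s => -(Real.exp s) + Real.exp s * s, fun s => -Real.exp s]
    ![Real.exp, fun _ => 1, fun t => t] (by
      intro s _ t _
      simp only [Fin.sum_univ_three, cons_val_zero, cons_val_one, cons_val]
      have h1 := Real.add_one_le_exp (t - s)
      have h2 : Real.exp t = Real.exp s * Real.exp (t - s) := by rw [← Real.exp_add]; ring_nf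
      nlinarith [Real.exp_pos s])
  simp only [Fin.sum_univ_three, cons_val_zero, cons_val_one, cons_val] at h
  have h2 : cfc (fun s => -(Real.exp s) + Real.exp s * s) X
      = -(cfc Real.exp X) + cfc Real.exp X * X := by
    rw [cfc_add X _ _ (X.finite_real_spectrum.continuousOn _)
      (X.finite_real_spectrum.continuousOn _),
      ← cfc_mul_matrix, hX.cfc_id_matrix, cfc_neg]
  rw [hX.cfc_one_matrix, hY.cfc_one_matrix, hY.cfc_id_matrix, h2, cfc_neg] at h
  simp only [one_mul, mul_one, trace_add, trace_neg, neg_mul] at h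
  rw [mul_sub, trace_sub]
  linarith

/-- Jensen for the concave map `y ↦ y ^ s`: the squared coordinates of the unit vector `u` in an
eigenbasis are probability weights. -/
theorem dotProduct_cfc_exp_mul_le_rpow (hX : X.IsHermitian) {u : ι → ℝ} (hu : u ⬝ᵥ u = 1)
    {s : ℝ} (hs0 : 0 ≤ s) (hs1 : s ≤ 1) :
    u ⬝ᵥ (cfc (fun y => Real.exp (s * y)) X *ᵥ u) ≤ (u ⬝ᵥ (cfc Real.exp X *ᵥ u)) ^ s := by
  rw [hX.dotProduct_cfc, hX.dotProduct_cfc]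
  have h := (Real.concaveOn_rpow hs0 hs1).le_map_sum (t := Finset.univ)
    (w := fun i => (u ⬝ᵥ hX.eigvec i) ^ 2) (p := fun i => Real.exp (hX.eigenvalues i))
    (fun i _ => sq_nonneg _) (by rw [hX.sum_sq_dotProduct_eigvec, hu])
    (fun i _ => (Real.exp_pos _).le)
  simp only [smul_eq_mul] at h
  refine le_trans (le_of_eq ?_) (h.trans (le_of_eq ?_))
  · refine Finset.sum_congr rfl fun i _ => ?_
    rw [mul_comm, ← Real.exp_mul, mul_comm s]
  · congr 1
    exact Finset.sum_congr rfl fun i _ => mul_comm _ _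

theorem isHermitian_vecMulVec {ι : Type*} (u : ι → ℝ) : (vecMulVec u u).IsHermitian := by
  ext i j
  simp [vecMulVec_apply, mul_comm]

theorem trace_mul_vecMulVec {ι : Type*} [Fintype ι] (M : Matrix ι ι ℝ) (u : ι → ℝ) :
    (M * vecMulVec u u).trace = u ⬝ᵥ (M *ᵥ u) := by
  rw [mul_vecMulVec, trace_vecMulVec, dotProduct_comm]

/-- In the eigenbases of `X` and `Y` the function is a finite sum of scalar exponentials, so only
scalar derivatives occur although `X` and `Y` need not commute. -/
theorem hasDerivAt_duhamel (hX : X.IsHermitian) (hY : Y.IsHermitian) (u : ι → ℝ) (s : ℝ) :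
    HasDerivAt (fun s : ℝ => u ⬝ᵥ ((cfc (fun y => Real.exp ((1 - s) * y)) X *
        cfc (fun y => Real.exp (s * y)) Y) *ᵥ u))
      (u ⬝ᵥ ((cfc (fun y => Real.exp ((1 - s) * y)) X * (Y - X) *
        cfc (fun y => Real.exp (s * y)) Y) *ᵥ u)) s := by
  have hd : cfc (fun y => Real.exp ((1 - s) * y)) X * (Y - X) * cfc (fun y => Real.exp (s * y)) Y
      = cfc (fun y => Real.exp ((1 - s) * y)) X * cfc (fun y => y * Real.exp (s * y)) Y
        - cfc (fun y => Real.exp ((1 - s) * y) * y) X * cfc (fun y => Real.exp (s * y)) Y := by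
    rw [← cfc_mul_matrix, ← cfc_mul_matrix, hX.cfc_id_matrix, hY.cfc_id_matrix]
    noncomm_ring
  rw [hd, sub_mulVec, dotProduct_sub]
  simp_rw [hX.dotProduct_cfc_mul_cfc hY]
  rw [← Finset.sum_sub_distrib]
  simp_rw [← Finset.sum_sub_distrib]
  refine HasDerivAt.fun_sum fun i _ => HasDerivAt.fun_sum fun j _ => ?_
  rw [← sub_mul]
  refine HasDerivAt.mul_const ?_ _
  have h1 : HasDerivAt (fun s : ℝ => Real.exp ((1 - s) * hX.eigenvalues i))
      (Real.exp ((1 - s) * hX.eigenvalues i) * (-1 * hX.eigenvalues i)) s :=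
    (((hasDerivAt_id s).const_sub 1).mul_const _).exp
  have h2 : HasDerivAt (fun s : ℝ => Real.exp (s * hY.eigenvalues j))
      (Real.exp (s * hY.eigenvalues j) * (1 * hY.eigenvalues j)) s :=
    ((hasDerivAt_id s).mul_const _).exp
  refine (h1.fun_mul h2).congr_deriv ?_
  ring

theorem dotProduct_cfc_exp_pos (hX : X.IsHermitian) {u : ι → ℝ} (hu : u ⬝ᵥ u = 1) :
    0 < u ⬝ᵥ (cfc Real.exp X *ᵥ u) := by
  have h := (hX.posDef_cfc (f := Real.exp) fun s _ => Real.exp_pos s).dotProduct_mulVec_pos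
    (x := u) (by rintro rfl; simp at hu)
  simpa using h

/-- Along the Duhamel path `ψ` from `a` to `b`, the rank-one form of `Y - X` splits the derivative
into `-β` times a product of two quadratic forms, which Jensen bounds by `a ^ (1 - s) * b ^ s`.
Integrating gives `a - b ≤ β (a - b) / log (a / b)`, hence `log (a / b) ≤ β`. -/
theorem dotProduct_cfc_exp_sub_rankOne_ge (hX : X.IsHermitian) {u : ι → ℝ} (hu : u ⬝ᵥ u = 1)
    {β : ℝ} (hβ : 0 ≤ β) :
    Real.exp (-β) * (u ⬝ᵥ (cfc Real.exp X *ᵥ u)) ≤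
      u ⬝ᵥ (cfc Real.exp (X - β • vecMulVec u u) *ᵥ u) := by
  set Y := X - β • vecMulVec u u with hYdef
  have hY : Y.IsHermitian := hX.sub ((isHermitian_vecMulVec u).smul (IsSelfAdjoint.all β))
  set a := u ⬝ᵥ (cfc Real.exp X *ᵥ u) with ha
  set b := u ⬝ᵥ (cfc Real.exp Y *ᵥ u) with hb
  have ha0 : 0 < a := hX.dotProduct_cfc_exp_pos hu
  have hb0 : 0 < b := hY.dotProduct_cfc_exp_pos hu
  rcases le_or_gt a b with hab | hab
  · have : Real.exp (-β) ≤ 1 := Real.exp_le_one_iff.2 (by linarith)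
    nlinarith
  set r := Real.log a - Real.log b with hr
  have hr0 : 0 < r := sub_pos.2 (Real.log_lt_log hb0 hab)
  have hbr : b = a * Real.exp (-r) := by
    rw [hr, neg_sub, Real.exp_sub, Real.exp_log ha0, Real.exp_log hb0]
    field_simp
  set ψ : ℝ → ℝ := fun s => u ⬝ᵥ ((cfc (fun y => Real.exp ((1 - s) * y)) X *
        cfc (fun y => Real.exp (s * y)) Y) *ᵥ u) with hψ
  -- The subtracted term is an antiderivative of the lower bound `-β a e^{-r s}` for `ψ'`, so
  -- monotonicity replaces integration.
  have hψd : ∀ s, HasDerivAt (fun s => ψ s - β / r * a * Real.exp (-r * s))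
      (-β * ((u ⬝ᵥ (cfc (fun y => Real.exp ((1 - s) * y)) X *ᵥ u)) *
        (u ⬝ᵥ (cfc (fun y => Real.exp (s * y)) Y *ᵥ u))) + β * a * Real.exp (-r * s)) s := by
    intro s
    have h1 := hX.hasDerivAt_duhamel hY u s
    have h2 : HasDerivAt (fun s : ℝ => β / r * a * Real.exp (-r * s))
        (β / r * a * (Real.exp (-r * s) * (-r * 1))) s :=
      (((hasDerivAt_id s).const_mul (-r)).exp).const_mul _
    refine (h1.fun_sub h2).congr_deriv ?_
    have h3 : Y - X = -β • vecMulVec u u := by rw [hYdef]; simp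
    rw [h3, mul_smul_comm, smul_mul_assoc, smul_mulVec, dotProduct_smul, mul_vecMulVec,
      vecMulVec_mul, vecMulVec_mulVec, ← dotProduct_mulVec]
    simp only [dotProduct_smul, op_smul_eq_smul, smul_eq_mul]
    field_simp
    ring
  have hmono : MonotoneOn (fun s => ψ s - β / r * a * Real.exp (-r * s)) (Set.Icc 0 1) := by
    refine monotoneOn_of_deriv_nonneg (convex_Icc 0 1)
      (fun s _ => (hψd s).continuousAt.continuousWithinAt)
      (fun s _ => (hψd s).differentiableAt.differentiableWithinAt) ?_
    intro s hs
    rw [interior_Icc] at hs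
    rw [(hψd s).deriv]
    have h1 := hX.dotProduct_cfc_exp_mul_le_rpow hu (s := 1 - s) (by linarith [hs.2])
      (by linarith [hs.1])
    have h2 := hY.dotProduct_cfc_exp_mul_le_rpow hu hs.1.le hs.2.le
    have h3 : a ^ (1 - s) * b ^ s = a * Real.exp (-r * s) := by
      rw [hbr, Real.mul_rpow ha0.le (Real.exp_pos _).le, ← Real.exp_mul, ← mul_assoc,
        ← Real.rpow_add ha0]
      simp
    have h4 : 0 ≤ u ⬝ᵥ (cfc (fun y => Real.exp (s * y)) Y *ᵥ u) := by
      rw [hY.dotProduct_cfc]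
      exact Finset.sum_nonneg fun i _ => mul_nonneg (Real.exp_pos _).le (sq_nonneg _)
    have h5 := mul_le_mul h1 h2 h4 (Real.rpow_nonneg ha0.le _)
    rw [h3] at h5
    nlinarith
  have h01 := hmono (Set.left_mem_Icc.2 zero_le_one) (Set.right_mem_Icc.2 zero_le_one) zero_le_one
  have hψ0 : ψ 0 = a := by simp [hψ, hY.cfc_one_matrix, ha]
  have hψ1 : ψ 1 = b := by simp [hψ, hX.cfc_one_matrix, hb]
  simp only [hψ0, hψ1, mul_zero, Real.exp_zero, mul_one] at h01
  have hrβ : r ≤ β := by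
    have h6 : (β / r) * (a - b) ≥ a - b := by rw [hbr] at h01 ⊢; linarith
    have h7 : 1 ≤ β / r := by
      by_contra hlt
      push Not at hlt
      nlinarith
    rwa [one_le_div hr0] at h7
  rw [hbr, mul_comm]
  exact mul_le_mul_of_nonneg_left (Real.exp_le_exp.2 (by linarith)) ha0.le

/-- A discrete form of `d/dβ Tr exp(X - β u uᵀ) ≤ -e^{-β} uᵀ exp(X) u`, using the tangent at the
endpoint `b`. The factor `e^{-(b - a)}` is the discretization loss; it tends to `1` as the mesh
shrinks. -/
theorem trace_exp_sub_rankOne_step (hX : X.IsHermitian) {u : ι → ℝ} (hu : u ⬝ᵥ u = 1)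
    {a b : ℝ} (hb : 0 ≤ b) (hab : a ≤ b) :
    (cfc Real.exp (X - b • vecMulVec u u)).trace +
        (Real.exp (-a) - Real.exp (-b)) * Real.exp (-(b - a)) * (u ⬝ᵥ (cfc Real.exp X *ᵥ u)) ≤
      (cfc Real.exp (X - a • vecMulVec u u)).trace := by
  have hP (c : ℝ) : (X - c • vecMulVec u u).IsHermitian :=
    hX.sub ((isHermitian_vecMulVec u).smul (IsSelfAdjoint.all c))
  have h1 := (hP b).trace_exp_tangent_le (hP a)
  have h2 : X - a • vecMulVec u u - (X - b • vecMulVec u u) = (b - a) • vecMulVec u u := by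
    rw [sub_smul]; abel
  rw [h2, mul_smul_comm, trace_smul, trace_mul_vecMulVec, smul_eq_mul] at h1
  have h3 := hX.dotProduct_cfc_exp_sub_rankOne_ge hu hb
  have h4 : (Real.exp (-a) - Real.exp (-b)) * Real.exp (-(b - a)) ≤ (b - a) * Real.exp (-b) := by
    have h5 : Real.exp (-a) * Real.exp (-(b - a)) = Real.exp (-b) := by
      rw [← Real.exp_add]; ring_nf
    have h6 := Real.add_one_le_exp (-(b - a))
    rw [sub_mul, h5]
    nlinarith [Real.exp_pos (-b)]
  have h7 := mul_le_mul_of_nonneg_right h4 (hX.dotProduct_cfc_exp_pos hu).le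
  have h8 := mul_le_mul_of_nonneg_left h3 (sub_nonneg.2 hab)
  linarith

/-- The **Golden–Thompson inequality** `Tr exp (X - β u uᵀ) ≤ Tr (exp X exp (-β u uᵀ))` for a unit
vector `u`. -/
theorem trace_exp_sub_rankOne_le (hX : X.IsHermitian) {u : ι → ℝ} (hu : u ⬝ᵥ u = 1)
    {β : ℝ} (hβ : 0 ≤ β) :
    (cfc Real.exp (X - β • vecMulVec u u)).trace ≤
      (cfc Real.exp X).trace - (1 - Real.exp (-β)) * (u ⬝ᵥ (cfc Real.exp X *ᵥ u)) := by
  set g := u ⬝ᵥ (cfc Real.exp X *ᵥ u) with hg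
  have key : ∀ N : ℕ, ∀ δ : ℝ, 0 ≤ δ →
      (cfc Real.exp (X - ((N : ℝ) * δ) • vecMulVec u u)).trace +
        (1 - Real.exp (-((N : ℝ) * δ))) * Real.exp (-δ) * g ≤ (cfc Real.exp X).trace := by
    intro N δ hδ
    induction N with
    | zero => simp
    | succ N ih =>
      have h := hX.trace_exp_sub_rankOne_step hu (a := N * δ) (b := (N + 1 : ℕ) * δ)
        (by positivity) (by push_cast; nlinarith)
      have h2 : ((N + 1 : ℕ) : ℝ) * δ - N * δ = δ := by push_cast; ring
      rw [h2] at h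
      linarith
  -- Divide `[0, β]` into `N + 1` equal steps and let `N` grow; the loss factor disappears.
  have hlim : Filter.Tendsto (fun N : ℕ => (cfc Real.exp (X - β • vecMulVec u u)).trace +
      (1 - Real.exp (-β)) * Real.exp (-(β / ((N : ℝ) + 1))) * g) Filter.atTop
      (nhds ((cfc Real.exp (X - β • vecMulVec u u)).trace +
        (1 - Real.exp (-β)) * Real.exp (-0) * g)) := by
    have h0 : Filter.Tendsto (fun N : ℕ => β / ((N : ℝ) + 1)) Filter.atTop (nhds 0) :=
      tendsto_const_div_atTop_nhds_zero_nat β |>.comp (Filter.tendsto_add_atTop_nat 1) |>.congr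
        (by intro N; simp)
    exact (((Real.continuous_exp.tendsto _).comp h0.neg).const_mul _ |>.mul_const _).const_add _
  have := le_of_tendsto' hlim (b := (cfc Real.exp X).trace) (fun N => by
    have h := key (N + 1) (β / ((N : ℝ) + 1)) (by positivity)
    have h2 : ((N + 1 : ℕ) : ℝ) * (β / ((N : ℝ) + 1)) = β := by push_cast; field_simp
    rwa [h2] at h)
  simp only [neg_zero, Real.exp_zero, mul_one] at this
  linarith

/-- Unnormalized form of `trace_exp_sub_rankOne_le`; the quotient is read as `0` at `v = 0`. -/
theorem trace_exp_sub_smul_vecMulVec_le (hX : X.IsHermitian) (v : ι → ℝ) {α : ℝ} (hα : 0 ≤ α) :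
    (cfc Real.exp (X - α • vecMulVec v v)).trace ≤ (cfc Real.exp X).trace -
      (1 - Real.exp (-α * (v ⬝ᵥ v))) * (v ⬝ᵥ (cfc Real.exp X *ᵥ v) / (v ⬝ᵥ v)) := by
  by_cases hv : v = 0
  · subst hv
    simp
  have hvv : 0 < v ⬝ᵥ v := by
    have := dotProduct_star_self_pos_iff.2 hv
    simpa using this
  set c := Real.sqrt (v ⬝ᵥ v) with hc
  have hc0 : 0 < c := Real.sqrt_pos.2 hvv
  have hcc : v ⬝ᵥ v = c ^ 2 := (Real.sq_sqrt hvv.le).symm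
  have hvu : v = c • (c⁻¹ • v) := by rw [smul_smul, mul_inv_cancel₀ hc0.ne', one_smul]
  have hu : (c⁻¹ • v) ⬝ᵥ (c⁻¹ • v) = 1 := by
    rw [smul_dotProduct, dotProduct_smul, hcc]
    simp only [smul_eq_mul]
    field_simp
  have h := hX.trace_exp_sub_rankOne_le hu (β := α * (v ⬝ᵥ v)) (by positivity)
  have h1 : (α * (v ⬝ᵥ v)) • vecMulVec (c⁻¹ • v) (c⁻¹ • v) = α • vecMulVec v v := by
    rw [smul_vecMulVec, vecMulVec_smul, smul_smul, smul_smul, hcc]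
    congr 1
    field_simp
  have h2 : (c⁻¹ • v) ⬝ᵥ (cfc Real.exp X *ᵥ (c⁻¹ • v)) =
      v ⬝ᵥ (cfc Real.exp X *ᵥ v) / (v ⬝ᵥ v) := by
    rw [mulVec_smul, smul_dotProduct, dotProduct_smul, hcc]
    simp only [smul_eq_mul]
    field_simp
  rw [h1, h2] at h
  simpa only [neg_mul] using h

end Matrix.IsHermitian

/-! ### Exponentials of shifted and scaled matrices. -/

namespace Matrix.IsHermitian

variable {ι : Type*} [Fintype ι] [DecidableEq ι] {X : Matrix ι ι ℝ}

theorem sub_smul_one {ι : Type*} [DecidableEq ι] {X : Matrix ι ι ℝ} (hX : X.IsHermitian) (c : ℝ) :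
    (X - c • (1 : Matrix ι ι ℝ)).IsHermitian :=
  hX.sub (isHermitian_one.smul (IsSelfAdjoint.all c))

theorem cfc_add_const_matrix (hX : X.IsHermitian) (c : ℝ) :
    cfc (fun s => s + c) X = X + c • (1 : Matrix ι ι ℝ) := by
  have h : IsSelfAdjoint X := hX
  rw [cfc_add X _ _ (X.finite_real_spectrum.continuousOn _)
    (X.finite_real_spectrum.continuousOn _), hX.cfc_id_matrix, cfc_const c X,
    Algebra.algebraMap_eq_smul_one]

theorem cfc_exp_sub_smul_one (hX : X.IsHermitian) (c : ℝ) :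
    cfc Real.exp (X - c • (1 : Matrix ι ι ℝ)) = Real.exp (-c) • cfc Real.exp X := by
  have h : X - c • (1 : Matrix ι ι ℝ) = cfc (fun s => s + -c) X := by
    rw [hX.cfc_add_const_matrix, neg_smul, sub_eq_add_neg]
  rw [h, hX.cfc_comp_matrix, ← cfc_smul _ _ X (X.finite_real_spectrum.continuousOn _)]
  refine cfc_congr fun s _ => ?_
  simp only [smul_eq_mul]
  rw [Real.exp_add, mul_comm]

theorem trace_cfc_exp_pos [Nonempty ι] (hX : X.IsHermitian) : 0 < (cfc Real.exp X).trace := by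
  rw [hX.trace_cfc]
  exact Finset.sum_pos (fun i _ => Real.exp_pos _) Finset.univ_nonempty

theorem cfc_affine_matrix (hX : X.IsHermitian) (a c : ℝ) :
    cfc (fun s => a * s + c) X = a • X + c • (1 : Matrix ι ι ℝ) := by
  have h : a • X = cfc (fun s => a * s) X := by
    conv_lhs => rw [← hX.cfc_id_matrix, ← cfc_smul _ _ X (X.finite_real_spectrum.continuousOn _)]
    rfl
  have hX' : IsHermitian (a • X) := hX.smul (IsSelfAdjoint.all a)
  rw [← hX'.cfc_add_const_matrix, h, hX.cfc_comp_matrix]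

theorem exp_mul_le_trace_cfc_exp_smul (hX : X.IsHermitian) {μ : ℝ} (hμ : μ ∈ spectrum ℝ X)
    (c : ℝ) : Real.exp (c * μ) ≤ (cfc Real.exp (c • X)).trace := by
  have h := hX.cfc_affine_matrix c 0
  rw [zero_smul, add_zero] at h
  rw [hX.spectrum_real_eq_range_eigenvalues] at hμ
  obtain ⟨i, rfl⟩ := hμ
  rw [← h, hX.cfc_comp_matrix, hX.trace_cfc]
  refine le_trans (le_of_eq ?_) (Finset.single_le_sum
    (f := fun i => Real.exp (c * hX.eigenvalues i + 0)) (fun j _ => (Real.exp_pos _).le)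
    (Finset.mem_univ i))
  simp

end Matrix.IsHermitian

/-! ### The two FTRL minimizers. -/

namespace RegDesign

open Matrix Matrix.IsHermitian

variable {d : ℕ} {M K A S R : Matrix (Fin d) (Fin d) ℝ}

theorem exp_mlog (hM : M.PosDef) : cfc Real.exp (mlog M) = M := by
  rw [mlog, hM.1.cfc_comp_matrix]
  conv_rhs => rw [← hM.1.cfc_id_matrix]
  exact cfc_congr fun s hs => Real.exp_log ((posDef_iff_spectrum hM.1).1 hM s hs)

theorem mlog_exp (hK : K.IsHermitian) : mlog (cfc Real.exp K) = K := by
  rw [mlog, hK.cfc_comp_matrix]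
  simp_rw [Real.log_exp]
  exact hK.cfc_id_matrix

theorem posDef_exp (hK : K.IsHermitian) : (cfc Real.exp K).PosDef :=
  hK.posDef_cfc fun _ _ => Real.exp_pos _

theorem mpow_half_mul_self (hM : M.PosSemidef) : mpow M (1 / 2) * mpow M (1 / 2) = M := by
  rw [mpow, cfc_mul_matrix]
  conv_rhs => rw [← hM.1.cfc_id_matrix]
  refine cfc_congr fun s hs => ?_
  have h := (posSemidef_iff_spectrum hM.1).1 hM s hs
  simp only [← Real.sqrt_eq_rpow, Real.mul_self_sqrt h]

theorem mpow_half_posSemidef (hM : M.PosSemidef) : (mpow M (1 / 2)).PosSemidef := by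
  rw [mpow, posSemidef_iff_spectrum (cfc_isHermitian _ M), spectrum_cfc hM.1]
  rintro _ ⟨s, hs, rfl⟩
  exact Real.rpow_nonneg ((posSemidef_iff_spectrum hM.1).1 hM s hs) _

theorem mpow_posDef (hM : M.PosDef) (r : ℝ) : (mpow M r).PosDef :=
  hM.1.posDef_cfc fun s hs => Real.rpow_pos_of_pos ((posDef_iff_spectrum hM.1).1 hM s hs) _

theorem mpow_half_of_mul_self (hR : R.PosSemidef) : mpow (R * R) (1 / 2) = R := by
  have h : R * R = cfc (fun s : ℝ => s * s) R := by
    rw [← cfc_mul_matrix, hR.1.cfc_id_matrix]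
  rw [h, mpow, hR.1.cfc_comp_matrix]
  conv_rhs => rw [← hR.1.cfc_id_matrix]
  refine cfc_congr fun s hs => ?_
  simp only [← Real.sqrt_eq_rpow, Real.sqrt_mul_self ((posSemidef_iff_spectrum hR.1).1 hR s hs)]

theorem mpow_neg_half (hM : M.PosDef) : mpow M (-1 / 2) = (mpow M (1 / 2))⁻¹ := by
  symm
  apply inv_eq_right_inv
  rw [mpow, mpow, cfc_mul_matrix, ← hM.1.cfc_one_matrix]
  refine cfc_congr fun s hs => ?_
  rw [← Real.rpow_add ((posDef_iff_spectrum hM.1).1 hM s hs)]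
  norm_num

theorem frob_eq_trace_mul (hM : M.IsHermitian) (S : Matrix (Fin d) (Fin d) ℝ) :
    frob M S = (M * S).trace := by
  have h : Mᵀ = M := by simpa using hM.eq
  rw [frob, h]

/-- The quantitative **Gibbs variational principle**: the Bregman divergence of the entropy
dominates the squared Frobenius distance of the square roots. -/
theorem trace_sq_sqrt_sub_le (hM : M.PosSemidef) (hK : K.IsHermitian) :
    ((mpow M (1 / 2) - cfc (fun t => Real.exp (t / 2)) K) *
      (mpow M (1 / 2) - cfc (fun t => Real.exp (t / 2)) K)).trace ≤
    (M * mlog M).trace - (M * K).trace + (cfc Real.exp K).trace - M.trace := by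
  -- Once the square is expanded, the scalar claim is `s log s - s t + 2 √s e^{t/2} - 2 s ≥ 0`,
  -- which is `1 + y ≤ e^y` at `y = (t - log s) / 2`; at `s = 0` every term vanishes.
  have h := hM.1.sum_trace_cfc_mul_cfc_nonneg hK
    ![fun s => s * Real.log s, fun s => s, fun s => s ^ (1 / 2 : ℝ), fun s => s]
    ![fun _ => 1, fun t => -t, fun t => 2 * Real.exp (t / 2), fun _ => -2] (by
      intro s hs t _
      have hs0 := (posSemidef_iff_spectrum hM.1).1 hM s hs
      simp only [Fin.sum_univ_four, cons_val_zero, cons_val_one, cons_val]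
      rw [← Real.sqrt_eq_rpow]
      rcases hs0.eq_or_lt with rfl | hs0
      · simp
      have hq := Real.sqrt_pos.2 hs0
      have h1 := Real.add_one_le_exp (t / 2 - Real.log s / 2)
      have h2 : Real.exp (t / 2 - Real.log s / 2) = Real.exp (t / 2) / Real.sqrt s := by
        rw [Real.exp_sub, ← Real.log_sqrt hs0.le, Real.exp_log hq]
      rw [h2, le_div_iff₀ hq] at h1
      have h3 := Real.mul_self_sqrt hs0.le
      have h4 := mul_le_mul_of_nonneg_left h1 hq.le
      have h5 : √s * ((t / 2 - Real.log s / 2 + 1) * √s) = s * (t / 2 - Real.log s / 2 + 1) := by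
        linear_combination (t / 2 - Real.log s / 2 + 1) * h3
      rw [h5] at h4
      linarith)
  simp only [Fin.sum_univ_four, cons_val_zero, cons_val_one, cons_val] at h
  have e1 : cfc (fun s => s * Real.log s) M = M * mlog M := by
    rw [← cfc_mul_matrix, hM.1.cfc_id_matrix, mlog]
  have e2 : cfc (fun t : ℝ => -t) K = -K := by rw [cfc_neg, hK.cfc_id_matrix]
  have e3 : cfc (fun t => 2 * Real.exp (t / 2)) K = (2 : ℝ) • cfc (fun t => Real.exp (t / 2)) K := by
    rw [← cfc_smul _ _ K (K.finite_real_spectrum.continuousOn _)]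
    rfl
  have e4 : cfc (fun _ : ℝ => (-2 : ℝ)) K = (-2 : ℝ) • (1 : Matrix (Fin d) (Fin d) ℝ) := by
    have hK' : IsSelfAdjoint K := hK
    rw [cfc_const _ K, Algebra.algebraMap_eq_smul_one]
  have e5 : cfc (fun t => Real.exp (t / 2)) K * cfc (fun t => Real.exp (t / 2)) K =
      cfc Real.exp K := by
    rw [cfc_mul_matrix]
    refine cfc_congr fun t _ => ?_
    rw [← Real.exp_add]
    ring_nf
  rw [e1, e2, e3, e4, hK.cfc_one_matrix, hM.1.cfc_id_matrix] at h
  change 0 ≤ _ + _ + (mpow M (1 / 2) * _).trace + _ at h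
  simp only [mul_one, mul_neg, mul_smul_comm, trace_neg, trace_smul, smul_eq_mul] at h
  have h5 := trace_mul_comm (cfc (fun t => Real.exp (t / 2)) K) (mpow M (1 / 2))
  simp only [mul_sub, sub_mul, trace_sub, mpow_half_mul_self hM, e5]
  linarith

theorem isHermitian_eq_zero_of_trace_mul_self (hR : R.IsHermitian) (h : (R * R).trace ≤ 0) :
    R = 0 := by
  have h1 : (Rᴴ * R).trace = 0 := by
    refine le_antisymm (by rwa [hR.eq]) ?_
    exact (posSemidef_conjTranspose_mul_self R).trace_nonneg
  exact trace_conjTranspose_mul_self_eq_zero_iff.1 h1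

/-- On the trace-one set the objective is the Gibbs divergence from `exp K` up to a constant. The
candidate `exp K` has divergence zero, so a minimizer has at most that, and the squared distance of
square roots forces `A^{1/2} = exp (K / 2)`. No derivative at the boundary is needed. -/
theorem entropy_minimizer_eq (hd : 0 < d) (hS : S.IsHermitian) {α : ℝ} (hA : A ∈ actionSet d)
    (hmin : IsMinOn (fun M => α * frob M S + entropyReg M) (actionSet d) A) :
    A = cfc Real.exp (-α • S - Real.log (cfc Real.exp (-α • S)).trace • 1) := by
  have : Nonempty (Fin d) := ⟨⟨0, hd⟩⟩
  have hT : (-α • S).IsHermitian := hS.smul (IsSelfAdjoint.all _)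
  set Z := (cfc Real.exp (-α • S)).trace with hZ
  have hZ0 : 0 < Z := hT.trace_cfc_exp_pos
  set K := -α • S - Real.log Z • (1 : Matrix (Fin d) (Fin d) ℝ) with hKdef
  have hK : K.IsHermitian := hT.sub_smul_one _
  have htr : (cfc Real.exp K).trace = 1 := by
    rw [hKdef, hT.cfc_exp_sub_smul_one, trace_smul, ← hZ, Real.exp_neg, Real.exp_log hZ0,
      smul_eq_mul, inv_mul_cancel₀ hZ0.ne']
  have hobj : ∀ M ∈ actionSet d, α * frob M S + entropyReg M =
      (M * mlog M).trace - (M * K).trace - Real.log Z - 1 := by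
    intro M hM
    rw [entropyReg, frob_eq_trace_mul hM.1.1, frob_eq_trace_mul hM.1.1, hKdef]
    simp only [mul_sub, trace_sub, mul_smul_comm, trace_smul, mul_one, hM.2, smul_eq_mul]
    ring
  have hE : cfc Real.exp K ∈ actionSet d := ⟨(posDef_exp hK).posSemidef, htr⟩
  have h := isMinOn_iff.1 hmin _ hE
  rw [hobj _ hE, hobj _ hA, mlog_exp hK] at h
  have h2 := trace_sq_sqrt_sub_le hA.1 hK
  rw [htr, hA.2] at h2
  have h3 := isHermitian_eq_zero_of_trace_mul_self
    ((mpow_half_posSemidef hA.1).1.sub (cfc_isHermitian (fun t => Real.exp (t / 2)) K))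
    (h2.trans (by linarith))
  rw [sub_eq_zero] at h3
  rw [← mpow_half_mul_self hA.1, h3, cfc_mul_matrix]
  refine cfc_congr fun t _ => ?_
  rw [← Real.exp_add]
  ring_nf

/-- The duality gap of the `ℓ_{1/2}` regularizer. -/
theorem trace_half_gap (hM : M.PosSemidef) (hK : K.PosDef) :
    ((mpow M (1 / 2) - K⁻¹) * K * (mpow M (1 / 2) - K⁻¹)).trace =
      (M * K).trace - 2 * (mpow M (1 / 2)).trace + K⁻¹.trace := by
  have hu : IsUnit K.det := hK.isUnit.map detMonoidHom
  set R := mpow M (1 / 2) with hR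
  have h1 : (R - K⁻¹) * K * (R - K⁻¹) = R * K * R - R - R + K⁻¹ := by
    rw [sub_mul, nonsing_inv_mul _ hu, mul_sub, sub_mul, sub_mul, one_mul, one_mul,
      mul_nonsing_inv_cancel_right _ _ hu]
    abel
  have h2 : (R * K * R).trace = (M * K).trace := by
    rw [trace_mul_comm, ← mul_assoc, mpow_half_mul_self hM]
  rw [h1]
  simp only [trace_add, trace_sub, h2]
  ring

theorem trace_half_gap_nonneg (hM : M.PosSemidef) (hK : K.PosDef) :
    0 ≤ (M * K).trace - 2 * (mpow M (1 / 2)).trace + K⁻¹.trace := by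
  rw [← trace_half_gap hM hK]
  have h := hK.posSemidef.conjTranspose_mul_mul_same (mpow M (1 / 2) - K⁻¹)
  rw [((mpow_half_posSemidef hM).1.sub hK.inv.1).eq] at h
  exact h.trace_nonneg

theorem eq_inv_mul_inv_of_trace_half_gap_le (hM : M.PosSemidef) (hK : K.PosDef)
    (h : (M * K).trace - 2 * (mpow M (1 / 2)).trace + K⁻¹.trace ≤ 0) : M = K⁻¹ * K⁻¹ := by
  set D := mpow M (1 / 2) - K⁻¹ with hD
  have hDs : D.IsHermitian := (mpow_half_posSemidef hM).1.sub hK.inv.1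
  have hps := hK.posSemidef.conjTranspose_mul_mul_same D
  rw [hDs.eq] at hps
  have h0 : D * K * D = 0 := by
    refine hps.trace_eq_zero_iff.1 (le_antisymm ?_ hps.trace_nonneg)
    rw [trace_half_gap hM hK]
    exact h
  -- A nonzero column `w = D e_j` would have `wᵀ K w > 0`, yet this is a diagonal entry of `D K D =
  -- 0`.
  have hD0 : D = 0 := by
    refine ext_of_mulVec_single fun j => ?_
    by_contra hne
    rw [zero_mulVec] at hne
    have hpos := hK.dotProduct_mulVec_pos hne
    rw [star_mulVec, hDs.eq, ← dotProduct_mulVec, mulVec_mulVec, mulVec_mulVec, h0] at hpos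
    simp at hpos
  rw [← mpow_half_mul_self hM, sub_eq_zero.1 hD0]

theorem exists_normalizing_shift (hd : 0 < d) (hS : S.IsHermitian) :
    ∃ ν : ℝ, (S + ν • (1 : Matrix (Fin d) (Fin d) ℝ)).PosDef ∧
      ((S + ν • (1 : Matrix (Fin d) (Fin d) ℝ))⁻¹ *
        (S + ν • (1 : Matrix (Fin d) (Fin d) ℝ))⁻¹).trace = 1 := by
  have : Nonempty (Fin d) := ⟨⟨0, hd⟩⟩
  obtain ⟨i₀, hi₀⟩ := Finite.exists_min hS.eigenvalues
  set m := hS.eigenvalues i₀ with hm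
  set h : ℝ → ℝ := fun ν => ∑ i, (1 / (hS.eigenvalues i + ν)) ^ 2 with hh
  have hd1 : (1 : ℝ) ≤ d := by exact_mod_cast hd
  have hsq : 1 ≤ Real.sqrt d := Real.one_le_sqrt.2 hd1
  -- With `m` the least eigenvalue: at `ν = 1 - m` its term alone equals `1`; at `ν = √d - m` each
  -- of the `d` terms is at most `1 / d`. The intermediate value theorem gives the shift.
  have hcont : ContinuousOn h (Set.Icc (1 - m) (Real.sqrt d - m)) := by
    refine continuousOn_finsetSum _ fun i _ => ?_
    refine (ContinuousOn.div continuousOn_const (by fun_prop) fun ν hν => ?_).pow 2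
    have := hi₀ i
    have := hν.1
    linarith
  have hleft : 1 ≤ h (1 - m) := by
    refine le_trans ?_ (Finset.single_le_sum (f := fun i => (1 / (hS.eigenvalues i + (1 - m))) ^ 2)
      (fun j _ => sq_nonneg _) (Finset.mem_univ i₀))
    simp [← hm]
  have hright : h (Real.sqrt d - m) ≤ 1 := by
    have hle : ∀ i ∈ Finset.univ, (1 / (hS.eigenvalues i + (Real.sqrt d - m))) ^ 2 ≤ 1 / (d : ℝ) := by
      intro i _
      rw [div_pow, one_pow]
      refine one_div_le_one_div_of_le (by linarith) ?_
      have h1 : Real.sqrt d ≤ hS.eigenvalues i + (Real.sqrt d - m) := by linarith [hi₀ i]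
      calc (d : ℝ) = Real.sqrt d ^ 2 := (Real.sq_sqrt (by linarith)).symm
        _ ≤ _ := by gcongr
    refine (Finset.sum_le_sum hle).trans (le_of_eq ?_)
    simp
    field_simp
  obtain ⟨ν, hν, hν1⟩ := intermediate_value_Icc' (by linarith) hcont ⟨hright, hleft⟩
  have hpos : ∀ s ∈ spectrum ℝ S, 0 < s + ν := by
    rw [hS.spectrum_real_eq_range_eigenvalues, Set.forall_mem_range]
    intro i
    linarith [hi₀ i, hν.1]
  have hK : S + ν • (1 : Matrix (Fin d) (Fin d) ℝ) = cfc (fun s => s + ν) S :=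
    (hS.cfc_add_const_matrix ν).symm
  have hKinv : (cfc (fun s => s + ν) S)⁻¹ = cfc (fun s => 1 / (s + ν)) S := by
    apply inv_eq_right_inv
    rw [cfc_mul_matrix, ← hS.cfc_one_matrix]
    refine cfc_congr fun s hs => ?_
    have := hpos s hs
    field_simp
  refine ⟨ν, hK ▸ hS.posDef_cfc hpos, ?_⟩
  rw [hK, hKinv, cfc_mul_matrix, hS.trace_cfc]
  refine Eq.trans ?_ hν1
  exact Finset.sum_congr rfl fun i _ => (sq _).symm

theorem half_minimizer_eq {α ν : ℝ} (hA : A ∈ actionSet d)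
    (hmin : IsMinOn (fun M => α * frob M S + halfReg M) (actionSet d) A)
    (hK : (α • S + ν • (1 : Matrix (Fin d) (Fin d) ℝ)).PosDef)
    (htr : ((α • S + ν • (1 : Matrix (Fin d) (Fin d) ℝ))⁻¹ *
      (α • S + ν • (1 : Matrix (Fin d) (Fin d) ℝ))⁻¹).trace = 1) :
    A = (α • S + ν • (1 : Matrix (Fin d) (Fin d) ℝ))⁻¹ *
      (α • S + ν • (1 : Matrix (Fin d) (Fin d) ℝ))⁻¹ := by
  set K := α • S + ν • (1 : Matrix (Fin d) (Fin d) ℝ) with hKdef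
  have hu : IsUnit K.det := hK.isUnit.map detMonoidHom
  have hobj : ∀ M ∈ actionSet d, α * frob M S + halfReg M =
      (M * K).trace - 2 * (mpow M (1 / 2)).trace - ν := by
    intro M hM
    rw [halfReg, frob_eq_trace_mul hM.1.1, hKdef]
    simp only [mul_add, trace_add, mul_smul_comm, trace_smul, mul_one, hM.2, smul_eq_mul]
    ring
  have hE : K⁻¹ * K⁻¹ ∈ actionSet d := by
    refine ⟨?_, htr⟩
    have h := posSemidef_conjTranspose_mul_self K⁻¹
    rwa [hK.inv.1.eq] at h
  have h := isMinOn_iff.1 hmin _ hE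
  rw [hobj _ hE, hobj _ hA, mpow_half_of_mul_self hK.inv.posSemidef,
    nonsing_inv_mul_cancel_right _ _ hu] at h
  exact eq_inv_mul_inv_of_trace_half_gap_le hA.1 hK (by linarith)

/-- The trace of the Sherman–Morrison formula. -/
theorem trace_inv_add_smul_vecMulVec {L : Matrix (Fin d) (Fin d) ℝ} (hL : L.PosDef)
    (v : Fin d → ℝ) {α : ℝ} (hα : 0 ≤ α) :
    (L + α • vecMulVec v v)⁻¹.trace =
      L⁻¹.trace - α * quad (L⁻¹ * L⁻¹) v / (1 + α * quad L⁻¹ v) := by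
  have hu : IsUnit L.det := hL.isUnit.map detMonoidHom
  have hq : 0 ≤ quad L⁻¹ v := by
    simpa [quad] using hL.inv.posSemidef.dotProduct_mulVec_nonneg v
  have hq1 : 0 < 1 + α * quad L⁻¹ v := by positivity
  have hT : (L⁻¹)ᵀ = L⁻¹ := by simpa using hL.inv.1.eq
  have hvec : v ᵥ* L⁻¹ = L⁻¹ *ᵥ v := by
    rw [← mulVec_transpose, hT]
  have hinv : (L + α • vecMulVec v v)⁻¹ =
      L⁻¹ - (α / (1 + α * quad L⁻¹ v)) • vecMulVec (L⁻¹ *ᵥ v) (L⁻¹ *ᵥ v) := by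
    apply inv_eq_right_inv
    rw [mul_sub, add_mul, add_mul, mul_nonsing_inv _ hu, mul_smul_comm, mul_vecMulVec, mulVec_mulVec,
      mul_nonsing_inv _ hu, one_mulVec, smul_mul_assoc, vecMulVec_mul, hvec, mul_smul_comm,
      smul_mul_assoc, vecMulVec_mul_vecMulVec, vecMulVec_smul]
    change 1 + α • vecMulVec v (L⁻¹ *ᵥ v) - ((α / (1 + α * quad L⁻¹ v)) • vecMulVec v (L⁻¹ *ᵥ v) +
      (α / (1 + α * quad L⁻¹ v)) • α • quad L⁻¹ v • vecMulVec v (L⁻¹ *ᵥ v)) = 1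
    rw [smul_smul, smul_smul, ← add_smul, add_sub_assoc, ← sub_smul]
    have : α - (α / (1 + α * quad L⁻¹ v) + α / (1 + α * quad L⁻¹ v) * (α * quad L⁻¹ v)) = 0 := by
      field_simp
      ring
    rw [mul_assoc, this, zero_smul, add_zero]
  rw [hinv, trace_sub, trace_smul, trace_vecMulVec, smul_eq_mul]
  have h2 : quad (L⁻¹ * L⁻¹) v = (L⁻¹ *ᵥ v) ⬝ᵥ (L⁻¹ *ᵥ v) := by
    rw [quad, ← mulVec_mulVec, dotProduct_mulVec v, hvec]
  rw [h2]
  ring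

end RegDesign

/-! ### One-step potential bounds and telescoping. -/

namespace RegDesign

open Matrix Matrix.IsHermitian

variable {d n k : ℕ}

theorem posDef_sigmaReg (x : Fin n → Fin d → ℝ) {p : Fin n → ℝ} (hp : ∀ i, 0 ≤ p i) {lam : ℝ}
    (hlam : 0 < lam) : (sigmaReg x p lam).PosDef := by
  refine PosDef.posSemidef_add (posSemidef_sum _ fun i _ => ?_) (PosDef.one.smul hlam)
  have h := posSemidef_vecMulVec_self_star (x i)
  rw [star_trivial] at h
  exact h.smul (hp i)

theorem isHermitian_regLoss (x : Fin n → Fin d → ℝ) {p : Fin n → ℝ} (hp : ∀ i, 0 ≤ p i) {lam : ℝ}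
    (hlam : 0 < lam) (k : ℕ) (i : Fin n) : (regLoss x p lam k i).IsHermitian :=
  (isHermitian_vecMulVec _).add
    ((posDef_sigmaReg x hp hlam).inv.1.smul (IsSelfAdjoint.all (lam / (k : ℝ))))

theorem le_lamMin (hd : 0 < d) {S : Matrix (Fin d) (Fin d) ℝ} (hS : S.IsHermitian) {c : ℝ}
    (h : ∀ μ ∈ spectrum ℝ S, c ≤ μ) : c ≤ lamMin S := by
  have : Nonempty (Fin d) := ⟨⟨0, hd⟩⟩
  exact le_csInf ⟨_, hS.eigenvalues_mem_spectrum_real ⟨0, hd⟩⟩ h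

/-- Summation of a one-step bound along the partial sums of `F`. -/
theorem add_sum_le_of_step {G : Type*} [AddCommMonoid G] (F : Fin k → G) (Φ : G → ℝ)
    (e : Fin k → ℝ)
    (h : ∀ t, Φ (∑ s ∈ Finset.univ.filter (fun s => s < t), F s + F t) + e t ≤
      Φ (∑ s ∈ Finset.univ.filter (fun s => s < t), F s)) :
    Φ (∑ t, F t) + ∑ t, e t ≤ Φ 0 := by
  -- Indexing by `ℕ` makes the full sum `P k` available as the last partial sum.
  set P : ℕ → G := fun j => ∑ s ∈ Finset.univ.filter (fun s : Fin k => s.val < j), F s with hP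
  have hsucc (t : Fin k) : P (t + 1) = P t + F t := by
    have hu : Finset.univ.filter (fun s : Fin k => s.val < t.val + 1) =
        insert t (Finset.univ.filter (fun s : Fin k => s.val < t.val)) := by
      ext s
      simp [Fin.ext_iff]
      omega
    simp only [hP]
    rw [hu, Finset.sum_insert (by simp), add_comm]
  have hsum : ∑ t : Fin k, (Φ (P (t + 1)) - Φ (P t)) = Φ (P k) - Φ (P 0) := by
    rw [Fin.sum_univ_eq_sum_range (fun j => Φ (P (j + 1)) - Φ (P j)) k,
      Finset.sum_range_sub (fun j => Φ (P j))]
  have hle : ∑ t : Fin k, (Φ (P (t + 1)) - Φ (P t)) ≤ ∑ t, -e t := by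
    refine Finset.sum_le_sum fun t _ => ?_
    rw [hsucc]
    have := h t
    simp only [Fin.lt_def] at this
    linarith
  have h0 : P 0 = 0 := by simp [hP]
  have hk : P k = ∑ t, F t := by simp [hP]
  rw [hsum, h0, hk, Finset.sum_neg_distrib] at hle
  linarith

theorem isFTRL_iff {w : Matrix (Fin d) (Fin d) ℝ → ℝ} {α : ℝ}
    {F A : Fin k → Matrix (Fin d) (Fin d) ℝ} :
    IsFTRL w α F A ↔ ∀ t, A t ∈ actionSet d ∧ IsMinOn (fun M => α *
      frob M (∑ s ∈ Finset.univ.filter (fun s => s < t), F s) + w M) (actionSet d) (A t) := by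
  simp only [IsFTRL, frob, Finset.mul_sum, trace_sum]

section Entropy

variable {x : Fin n → Fin d → ℝ} {p : Fin n → ℝ} {α lam : ℝ} {S A B G : Matrix (Fin d) (Fin d) ℝ}

theorem isEntropyModified_iff (hS : S.PosDef) :
    IsEntropyModified α lam k S A B ↔
      B = cfc Real.exp (mlog A - (α * lam / (k : ℝ)) • S⁻¹) := by
  have hH : (mlog A - (α * lam / (k : ℝ)) • S⁻¹).IsHermitian :=
    (cfc_isHermitian Real.log A).sub (hS.inv.1.smul (IsSelfAdjoint.all _))
  constructor
  · rintro ⟨hB, h⟩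
    rw [← h, exp_mlog hB]
  · rintro rfl
    exact ⟨posDef_exp hH, mlog_exp hH⟩

theorem entropy_step (hd : 0 < d) (hp : ∀ i, 0 ≤ p i) (hα : 0 < α) (hlam : 0 < lam)
    (i : Fin n) (hG : G.IsHermitian)
    (hA : A = cfc Real.exp (-α • G - Real.log (cfc Real.exp (-α • G)).trace • 1))
    (hB : IsEntropyModified α lam k (sigmaReg x p lam) A B) :
    Real.log (cfc Real.exp (-α • (G + regLoss x p lam k i))).trace + ((A - B).trace
      + (1 - Real.exp (-α * (denoised x p lam i ⬝ᵥ denoised x p lam i)))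
        * (quad B (denoised x p lam i) / (denoised x p lam i ⬝ᵥ denoised x p lam i))) ≤
      Real.log (cfc Real.exp (-α • G)).trace := by
  have : Nonempty (Fin d) := ⟨⟨0, hd⟩⟩
  set v := denoised x p lam i with hv
  have hT : (-α • G).IsHermitian := hG.smul (IsSelfAdjoint.all _)
  have hT' : (-α • (G + regLoss x p lam k i)).IsHermitian :=
    (hG.add (isHermitian_regLoss x hp hlam k i)).smul (IsSelfAdjoint.all _)
  set Z := (cfc Real.exp (-α • G)).trace with hZ
  set Z' := (cfc Real.exp (-α • (G + regLoss x p lam k i))).trace with hZ'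
  have hZ0 : 0 < Z := hT.trace_cfc_exp_pos
  have hZ0' : 0 < Z' := hT'.trace_cfc_exp_pos
  have hK := hT.sub_smul_one (Real.log Z)
  have hAtr : A.trace = 1 := by
    rw [hA, hT.cfc_exp_sub_smul_one, trace_smul, ← hZ, Real.exp_neg, Real.exp_log hZ0, smul_eq_mul,
      inv_mul_cancel₀ hZ0.ne']
  -- Passing from `A` to `B` absorbs the `Σ_⋄⁻¹` part of the loss, so only the rank-one part remains
  -- for Golden–Thompson.
  have hlogB : mlog B - α • vecMulVec v v =
      -α • (G + regLoss x p lam k i) - Real.log Z • (1 : Matrix (Fin d) (Fin d) ℝ) := by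
    rw [hB.2, hA, mlog_exp hK, regLoss, ← hv, smul_add, smul_add, smul_smul, mul_div_assoc]
    module
  have hlogBh : (mlog B).IsHermitian := cfc_isHermitian Real.log B
  have hGT := hlogBh.trace_exp_sub_smul_vecMulVec_le v hα.le
  rw [hlogB, hT'.cfc_exp_sub_smul_one, trace_smul, ← hZ', exp_mlog hB.1, Real.exp_neg,
    Real.exp_log hZ0, smul_eq_mul] at hGT
  have hlog := Real.log_le_sub_one_of_pos (mul_pos (inv_pos.2 hZ0) hZ0')
  rw [Real.log_mul (inv_pos.2 hZ0).ne' hZ0'.ne', Real.log_inv] at hlog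
  rw [trace_sub, hAtr, quad]
  linarith

end Entropy

section Half

variable {x : Fin n → Fin d → ℝ} {p : Fin n → ℝ} {α lam : ℝ} {S B G K : Matrix (Fin d) (Fin d) ℝ}

theorem posDef_inv_mul_inv (hK : K.PosDef) : (K⁻¹ * K⁻¹).PosDef := by
  have h : (K⁻¹ * 1 * K⁻¹).PosDef := by
    have h := PosDef.one.conjTranspose_mul_mul_same (B := K⁻¹)
      (mulVec_injective_of_isUnit hK.inv.isUnit)
    rwa [hK.inv.1.eq] at h
  rwa [mul_one] at h

/-- For `A = K⁻²` the defining equation reads `B^{-1/2} = K + (α λ / k) Σ_⋄⁻¹`, which has an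
explicit unique solution. -/
theorem isHalfModified_iff (hα : 0 < α) (hlam : 0 < lam) (hK : K.PosDef) (hS : S.PosDef) :
    IsHalfModified α lam k S (K⁻¹ * K⁻¹) B ↔
      B = (K + (α * lam / (k : ℝ)) • S⁻¹)⁻¹ * (K + (α * lam / (k : ℝ)) • S⁻¹)⁻¹ := by
  have hL : (K + (α * lam / (k : ℝ)) • S⁻¹).PosDef :=
    hK.add_posSemidef (hS.inv.posSemidef.smul (by positivity))
  have hinv {L : Matrix (Fin d) (Fin d) ℝ} (hL : L.PosDef) : mpow (L⁻¹ * L⁻¹) (-1 / 2) = L := by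
    rw [mpow_neg_half (posDef_inv_mul_inv hL), mpow_half_of_mul_self hL.inv.posSemidef,
      nonsing_inv_nonsing_inv _ (hL.isUnit.map detMonoidHom)]
  rw [IsHalfModified, hinv hK]
  constructor
  · rintro ⟨hB, h⟩
    rw [← h, mpow_neg_half hB, nonsing_inv_nonsing_inv _ ((mpow_posDef hB _).isUnit.map detMonoidHom),
      mpow_half_mul_self hB.posSemidef]
  · rintro rfl
    exact ⟨posDef_inv_mul_inv hL, hinv hL⟩

/-- The optimal values `ν + Tr (α G + ν I)⁻¹` of two consecutive rounds, where the shifts `ν`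
normalize the traces of `(α G + ν I)⁻²`. -/
theorem half_step (hp : ∀ i, 0 ≤ p i) (hα : 0 < α) (hlam : 0 < lam)
    (i : Fin n) {ν ν' : ℝ}
    (hK : (α • G + ν • (1 : Matrix (Fin d) (Fin d) ℝ)).PosDef)
    (hK' : (α • (G + regLoss x p lam k i) + ν' • (1 : Matrix (Fin d) (Fin d) ℝ)).PosDef)
    (htr' : ((α • (G + regLoss x p lam k i) + ν' • (1 : Matrix (Fin d) (Fin d) ℝ))⁻¹ *
      (α • (G + regLoss x p lam k i) + ν' • (1 : Matrix (Fin d) (Fin d) ℝ))⁻¹).trace = 1)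
    (hB : IsHalfModified α lam k (sigmaReg x p lam)
      ((α • G + ν • (1 : Matrix (Fin d) (Fin d) ℝ))⁻¹ *
        (α • G + ν • (1 : Matrix (Fin d) (Fin d) ℝ))⁻¹) B) :
    (ν' + (α • (G + regLoss x p lam k i) + ν' • (1 : Matrix (Fin d) (Fin d) ℝ))⁻¹.trace) +
      ((mpow ((α • G + ν • (1 : Matrix (Fin d) (Fin d) ℝ))⁻¹ *
        (α • G + ν • (1 : Matrix (Fin d) (Fin d) ℝ))⁻¹) (1 / 2) - mpow B (1 / 2)).trace +
        α * quad B (denoised x p lam i) /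
          (1 + α * quad (mpow B (1 / 2)) (denoised x p lam i))) ≤
      ν + (α • G + ν • (1 : Matrix (Fin d) (Fin d) ℝ))⁻¹.trace := by
  set v := denoised x p lam i with hv
  have hS := posDef_sigmaReg x hp hlam
  have hB' := (isHalfModified_iff hα hlam hK hS).1 hB
  set K := α • G + ν • (1 : Matrix (Fin d) (Fin d) ℝ) with hKdef
  set K' := α • (G + regLoss x p lam k i) + ν' • (1 : Matrix (Fin d) (Fin d) ℝ) with hKdef'
  set L := K + (α * lam / (k : ℝ)) • (sigmaReg x p lam)⁻¹ with hLdef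
  have hL : L.PosDef := hK.add_posSemidef (hS.inv.posSemidef.smul (by positivity))
  have hvv : (vecMulVec v v).PosSemidef := by
    have h := posSemidef_vecMulVec_self_star v
    rwa [star_trivial] at h
  have hW : (L + α • vecMulVec v v).PosDef := hL.add_posSemidef (hvv.smul hα.le)
  have hWK : L + α • vecMulVec v v = K' + (ν - ν') • (1 : Matrix (Fin d) (Fin d) ℝ) := by
    rw [hLdef, hKdef, hKdef', regLoss, ← hv, smul_add, smul_add, smul_smul, mul_div_assoc]
    module
  -- Testing the dual matrix `W = K' + (ν - ν') I` against the next minimizer `K'⁻²`, of trace one,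
  -- gives `ν' + Tr K'⁻¹ ≤ ν + Tr W⁻¹`.
  have hgap := trace_half_gap_nonneg (posDef_inv_mul_inv hK').posSemidef hW
  rw [mpow_half_of_mul_self hK'.inv.posSemidef, trace_inv_add_smul_vecMulVec hL v hα.le, hWK,
    mul_add, nonsing_inv_mul_cancel_right _ _ (hK'.isUnit.map detMonoidHom), mul_smul_comm, mul_one,
    trace_add, trace_smul, htr', smul_eq_mul, mul_one] at hgap
  rw [hB', mpow_half_of_mul_self hK.inv.posSemidef, mpow_half_of_mul_self hL.inv.posSemidef,
    trace_sub]
  linarith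

theorem half_potential_zero (hd : 0 < d) {ν : ℝ} (hK : (ν • (1 : Matrix (Fin d) (Fin d) ℝ)).PosDef)
    (htr : ((ν • (1 : Matrix (Fin d) (Fin d) ℝ))⁻¹ *
      (ν • (1 : Matrix (Fin d) (Fin d) ℝ))⁻¹).trace = 1) :
    ν + (ν • (1 : Matrix (Fin d) (Fin d) ℝ))⁻¹.trace = 2 * Real.sqrt d := by
  have hν : 0 < ν := by
    have h := hK.diag_pos (i := ⟨0, hd⟩)
    simpa using h
  have hinv : (ν • (1 : Matrix (Fin d) (Fin d) ℝ))⁻¹ = ν⁻¹ • 1 := by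
    apply inv_eq_right_inv
    rw [smul_mul_smul_comm, mul_inv_cancel₀ hν.ne', one_smul, mul_one]
  rw [hinv, smul_mul_smul_comm, mul_one, trace_smul, trace_one, Fintype.card_fin, smul_eq_mul]
    at htr
  have hdν : (d : ℝ) = ν ^ 2 := by
    field_simp at htr
    exact htr
  rw [hinv, trace_smul, trace_one, Fintype.card_fin, hdν, Real.sqrt_sq hν.le, smul_eq_mul]
  field_simp
  ring

theorem neg_mul_lt_of_posDef_shift (hG : G.IsHermitian) {ν μ : ℝ}
    (hK : (α • G + ν • (1 : Matrix (Fin d) (Fin d) ℝ)).PosDef) (hμ : μ ∈ spectrum ℝ G) :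
    -(α * μ) < ν := by
  rw [← hG.cfc_affine_matrix] at hK
  have h := (posDef_iff_spectrum hK.1).1 hK (α * μ + ν)
    (by rw [spectrum_cfc hG]; exact ⟨μ, hμ, rfl⟩)
  linarith

end Half

end RegDesign

/-! ### Assembly of the two regret bounds. -/

open RegDesign Matrix Matrix.IsHermitian in
theorem theorem4p2 {d n k : ℕ} (hd : 0 < d) (hk : 0 < k)
    (α lam : ℝ) (hα : 0 < α) (hlam : 0 < lam)
    (x : Fin n → Fin d → ℝ) (p : Fin n → ℝ) (hp : ∀ i, 0 ≤ p i) (hpk : ∑ i, p i = (k : ℝ))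
    (i : Fin k → Fin n) (F : Fin k → Matrix (Fin d) (Fin d) ℝ)
    (hF : ∀ t, F t = RegDesign.regLoss x p lam k (i t)) :
    (∀ A : Fin k → Matrix (Fin d) (Fin d) ℝ,
      RegDesign.IsFTRL RegDesign.entropyReg α F A →
        (∀ t, (A t).PosDef ∧
          ∃! M, RegDesign.IsEntropyModified α lam k (RegDesign.sigmaReg x p lam) (A t) M) ∧
        ∀ B : Fin k → Matrix (Fin d) (Fin d) ℝ,
          (∀ t, RegDesign.IsEntropyModified α lam k (RegDesign.sigmaReg x p lam) (A t) (B t)) →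
          -(Real.log d / α) + (1 / α) * ∑ t,
              ((A t - B t).trace
                + (1 - Real.exp (-α * (RegDesign.denoised x p lam (i t)
                      ⬝ᵥ RegDesign.denoised x p lam (i t))))
                  * (RegDesign.quad (B t) (RegDesign.denoised x p lam (i t))
                    / (RegDesign.denoised x p lam (i t) ⬝ᵥ RegDesign.denoised x p lam (i t))))
            ≤ RegDesign.lamMin (∑ t, F t)) ∧
    (∀ A : Fin k → Matrix (Fin d) (Fin d) ℝ,
      RegDesign.IsFTRL RegDesign.halfReg α F A →
        (∀ t, (A t).PosDef ∧
          ∃! M, RegDesign.IsHalfModified α lam k (RegDesign.sigmaReg x p lam) (A t) M) ∧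
        ∀ B : Fin k → Matrix (Fin d) (Fin d) ℝ,
          (∀ t, RegDesign.IsHalfModified α lam k (RegDesign.sigmaReg x p lam) (A t) (B t)) →
          -(2 * Real.sqrt d / α) + (1 / α) * ∑ t,
              ((RegDesign.mpow (A t) (1 / 2) - RegDesign.mpow (B t) (1 / 2)).trace
                + α * RegDesign.quad (B t) (RegDesign.denoised x p lam (i t))
                  / (1 + α * RegDesign.quad (RegDesign.mpow (B t) (1 / 2))
                      (RegDesign.denoised x p lam (i t))))
            ≤ RegDesign.lamMin (∑ t, F t)) := by
  have hS := posDef_sigmaReg x hp hlam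
  have hFt (t : Fin k) : (F t).IsHermitian := hF t ▸ isHermitian_regLoss x hp hlam k (i t)
  have hG (s : Finset (Fin k)) : (∑ t ∈ s, F t).IsHermitian :=
    isSelfAdjoint_sum s fun t _ => hFt t
  have hfinal {a b c : ℝ} (h : -(α * a) + b ≤ c) : -(c / α) + 1 / α * b ≤ a := by
    have h2 : -(c / α) + 1 / α * b = (b - c) / α := by ring
    rw [h2, div_le_iff₀ hα]
    linarith
  constructor
  · intro A hFTRL
    rw [isFTRL_iff] at hFTRL
    have hA (t : Fin k) := entropy_minimizer_eq hd (hG _) (hFTRL t).1 (hFTRL t).2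
    have hApd (t : Fin k) : (A t).PosDef := by
      rw [hA t]
      exact posDef_exp (((hG _).smul (IsSelfAdjoint.all _)).sub_smul_one _)
    refine ⟨fun t => ⟨hApd t, _, (isEntropyModified_iff hS).2 rfl, fun M hM =>
      (isEntropyModified_iff hS).1 hM⟩, fun B hB => ?_⟩
    refine le_lamMin hd (hG _) fun μ hμ => hfinal ?_
    have hsum := add_sum_le_of_step F (fun G => Real.log (cfc Real.exp (-α • G)).trace) _
      fun t => (hF t).symm ▸ entropy_step hd hp hα hlam (i t) (hG _) (hA t) (hB t)
    have h0 : Real.log (cfc Real.exp (-α • (0 : Matrix (Fin d) (Fin d) ℝ))).trace = Real.log d := by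
      rw [smul_zero, cfc_apply_zero, Real.exp_zero, map_one, trace_one, Fintype.card_fin]
    -- The trace of the exponential dominates each of its eigenvalues, so `-α μ ≤ Φ(F)`.
    have hend := Real.log_le_log (Real.exp_pos _) ((hG _).exp_mul_le_trace_cfc_exp_smul hμ (-α))
    rw [Real.log_exp] at hend
    simp only [h0] at hsum
    linarith
  · intro A hFTRL
    rw [isFTRL_iff] at hFTRL
    -- The shift is chosen as a total function of `G`, with value `0` off the symmetric matrices, so
    -- that the potential is a function of the partial sum alone and can be telescoped.
    have hν (G : Matrix (Fin d) (Fin d) ℝ) : ∃ ν : ℝ, G.IsHermitian →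
        (α • G + ν • (1 : Matrix (Fin d) (Fin d) ℝ)).PosDef ∧
        ((α • G + ν • (1 : Matrix (Fin d) (Fin d) ℝ))⁻¹ *
          (α • G + ν • (1 : Matrix (Fin d) (Fin d) ℝ))⁻¹).trace = 1 := by
      by_cases h : G.IsHermitian
      · obtain ⟨ν, hν⟩ := exists_normalizing_shift hd (S := α • G) (h.smul (IsSelfAdjoint.all α))
        exact ⟨ν, fun _ => hν⟩
      · exact ⟨0, fun h' => absurd h' h⟩
    choose ν hν using hν
    have hA (t : Fin k) := half_minimizer_eq (hFTRL t).1 (hFTRL t).2 (hν _ (hG _)).1 (hν _ (hG _)).2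
    have hiff (t : Fin k) (M : Matrix (Fin d) (Fin d) ℝ) := by
      have h := isHalfModified_iff (k := k) (B := M) hα hlam
        (hν _ (hG (Finset.univ.filter (fun s => s < t)))).1 hS
      rwa [← hA t] at h
    refine ⟨fun t => ⟨?_, _, (hiff t _).2 rfl, fun M hM => (hiff t M).1 hM⟩, fun B hB => ?_⟩
    · rw [hA t]
      exact posDef_inv_mul_inv (hν _ (hG _)).1
    refine le_lamMin hd (hG _) fun μ hμ => hfinal ?_
    have hsum := add_sum_le_of_step F
      (fun G => ν G + (α • G + ν G • (1 : Matrix (Fin d) (Fin d) ℝ))⁻¹.trace)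
      (fun t => (mpow (A t) (1 / 2) - mpow (B t) (1 / 2)).trace +
        α * quad (B t) (denoised x p lam (i t)) /
          (1 + α * quad (mpow (B t) (1 / 2)) (denoised x p lam (i t)))) fun t => by
        have hB' := hB t
        have h' := hν _ ((hG (Finset.univ.filter (fun s => s < t))).add (hFt t))
        rw [hA t] at hB' ⊢
        rw [hF t] at h' ⊢
        exact half_step hp hα hlam (i t) (hν _ (hG _)).1 h'.1 h'.2 hB'
    have h0 := hν 0 isHermitian_zero
    simp only [smul_zero, zero_add] at h0 hsum
    rw [half_potential_zero hd h0.1 h0.2] at hsum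
    -- Positivity of `α F + ν I` gives `-α μ < ν`, and `ν ≤ Φ(F)` because the inverse has
    -- nonnegative trace.
    have hend := neg_mul_lt_of_posDef_shift (hG _) (hν _ (hG _)).1 hμ
    have htr := (hν _ (hG Finset.univ)).1.inv.posSemidef.trace_nonneg
    linarith
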